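/- Let $N=Kn$ with $K,n$ positive integers, $\delta=1/K$ (so $n=\delta N$), and let $B(j)=\{i\in[N]:(j-1)n<i\le jn\}$, $j=1,\dots,K$. Let $J$ be a $\mathrm{GOE}(N)$ matrix, i.e. an $N\times N$ matrix with centered, jointly Gaussian entries with $\mathbb E J_{ij}J_{kl}=(\delta_{ik}\delta_{jl}+\delta_{il}\delta_{jk})/N$; let $\sigma^0$ be uniform on $\{\pm1\}^N$; let $U=(U^t_i)_{t\ge 0,\,i\in[N]}$ be i.i.d. uniform on $[0,1]$; assume that $J,\sigma^0,U$ are independent, and let $c:[0,1]\times\mathbb R\to\{\pm1\}$ be measurable. The block systematic scan is defined as follows: in pass $t=1,2,\dots$, starting from $\sigma^{t,0}=\sigma^{t-1}$, for $j=1,\dots,K$ in this order put $\sigma^{t,j}_i=c\big(U^t_i,(J\sigma^{t,j-1})_i\big)$ for $i\in B(j)$ and $\sigma^{t,j}_i=\sigma^{t,j-1}_i$ for $i\notin B(j)$; then $\sigma^t=\sigma^{t,K}$. Let $\sigma^{t|j}\in\mathbb R^N$ be the vector that agrees with $\sigma^t$ on $B(j)$ and vanishes off $B(j)$. For $t\ge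 0$ and $j\in\{1,\dots,K\}$ let $$\mathcal F^t_j=\sigma\Big(\{\sigma^0\}\cup\{J\sigma^{s|k}:0\le s<t,\ 1\le k\le K\}\cup\{J\sigma^{t|k}:1\le k<j\}\Big),$$ let $P^{(t)|k}$ be the orthogonal projector onto $\mathrm{span}\{\sigma^{0|k},\dots,\sigma^{t|k}\}$ (with $P^{(-1)|k}=0$), and let $$P=P^{(t)}(j)=\sum_{k<j}P^{(t)|k}+\sum_{k\ge j}P^{(t-1)|k}.$$ Let $\tilde J$ be a $\mathrm{GOE}(N)$ matrix independent of $(J,\sigma^0,U)$. Then $P$ is the orthogonal projector onto the span of all $\sigma^{s|k}$ with $(s,k)<(t,j)$ in the lexicographic order, $1\le k\le K$. Moreover, conditionally on $\mathcal F^t_j$, and more generally conditionally on any $\sigma$-field $\mathcal H$ with $\mathcal F^t_j\subseteq\mathcal H\subseteq\mathcal F^t_j\vee\sigma(U)$, $$(I-P)J(I-P)\ \stackrel{d}{=}\ (I-P)\tilde J(I-P)$$ and $$J\ \stackrel{d}{=}\ (I-P)\tilde J(I-P)+JP+PJ(I-P).$$ Here $X\stackrel{d}{=}Y$ conditionally on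 $\mathcal H$ means that $\Pr(X\in B\mid\mathcal H)=\Pr(Y\in B\mid\mathcal H)$ almost surely for every Borel set $B$ of $N\times N$ matrices. -/

import Mathlib

open MeasureTheory ProbabilityTheory

noncomputable section

/-- The product `σ`-algebra on matrices (entrywise measurability). -/
instance instMeasurableSpaceRealMatrix (m n : Type*) : MeasurableSpace (Matrix m n ℝ) :=
  inferInstanceAs (MeasurableSpace (m → n → ℝ))

/-- `J` is a `GOE(N)` matrix: its entries are centered and jointly Gaussian, with
`E[J i j * J k l] = (δ_{ik} δ_{jl} + δ_{il} δ_{jk}) / N`. -/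
structure IsGOE {Ω : Type*} {mΩ : MeasurableSpace Ω} {N : ℕ}
    (J : Ω → Matrix (Fin N) (Fin N) ℝ) (μ : Measure Ω) : Prop where
  hasGaussianLaw : HasGaussianLaw (fun ω => fun p : Fin N × Fin N => J ω p.1 p.2) μ
  mean_zero : ∀ i j, ∫ ω, J ω i j ∂μ = 0
  covariance_eq : ∀ i j k l, ∫ ω, J ω i j * J ω k l ∂μ =
    ((if i = k ∧ j = l then 1 else 0) + (if i = l ∧ j = k then 1 else 0)) / (N : ℝ)

/-- Under `μ`, the random variables `X` and `Y` have the same conditional law given the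
`σ`-algebra `m`. -/
structure CondIdentDistrib {Ω E : Type*} {mΩ : MeasurableSpace Ω} [MeasurableSpace E]
    (μ : Measure Ω) (m : MeasurableSpace Ω) (X Y : Ω → E) : Prop where
  le : m ≤ mΩ
  aemeasurable_fst : AEMeasurable X μ
  aemeasurable_snd : AEMeasurable Y μ
  condProb_eq : ∀ B : Set E, MeasurableSet B → μ⟦X ⁻¹' B | m⟧ =ᵐ[μ] μ⟦Y ⁻¹' B | m⟧

/-- A spin configuration in `{±1}^N`. -/
abbrev SpinConfig (N : ℕ) : Type := Fin N → ℤˣ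

/-- A spin configuration as a vector of `ℝ^N`. -/
def SpinConfig.toReal {N : ℕ} (s : SpinConfig N) : Fin N → ℝ := fun i => ((s i : ℤ) : ℝ)

/-- The `j`-th block of sites for blocks of size `n`, `j = 1, 2, …`. With sites numbered from `1`
it is `{i : (j - 1) n < i ≤ j n}`; the site numbered `i + 1` is `i : Fin N`. -/
def block (N n j : ℕ) : Set (Fin N) := {i | j * n < (i : ℕ) + 1 + n ∧ (i : ℕ) + 1 ≤ j * n}

open Classical in
/-- One update of block `j`: every spin of the block is replaced by `c (u i) (h i)`, where
`h = A s` are the local fields before the update; all other spins are unchanged. -/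
def blockUpdate {N : ℕ} (n : ℕ) (c : unitInterval → ℝ → ℤˣ) (A : Matrix (Fin N) (Fin N) ℝ)
    (u : Fin N → unitInterval) (j : ℕ) (s : SpinConfig N) : SpinConfig N :=
  fun i => if i ∈ block N n j then c (u i) (A.mulVec s.toReal i) else s i

/-- The configuration after blocks `1, …, j` have been updated, in this order, in one pass
started at `s` with seeds `u`. -/
def passState {N : ℕ} (n : ℕ) (c : unitInterval → ℝ → ℤˣ) (A : Matrix (Fin N) (Fin N) ℝ)
    (u : Fin N → unitInterval) (s : SpinConfig N) : ℕ → SpinConfig N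
  | 0 => s
  | j + 1 => blockUpdate n c A u (j + 1) (passState n c A u s j)

/-- The configuration `σ^t` at the end of pass `t` of the block systematic scan with `K` blocks of
size `n`, started at `s₀`; `σ^0 = s₀`, and pass `t` uses the seeds `u t`. -/
def scanState {N : ℕ} (K n : ℕ) (c : unitInterval → ℝ → ℤˣ) (A : Matrix (Fin N) (Fin N) ℝ)
    (u : ℕ → Fin N → unitInterval) (s₀ : SpinConfig N) : ℕ → SpinConfig N
  | 0 => s₀
  | t + 1 => passState n c A (u (t + 1)) (scanState K n c A u s₀ t) K

open Classical in
/-- The vector `σ^{t|j} = D^j σ^t`: the spins of block `j` after pass `t`, all other coordinates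
being set to zero. -/
def spinBlock {N : ℕ} (K n : ℕ) (c : unitInterval → ℝ → ℤˣ) (A : Matrix (Fin N) (Fin N) ℝ)
    (u : ℕ → Fin N → unitInterval) (s₀ : SpinConfig N) (t j : ℕ) : Fin N → ℝ :=
  fun i => if i ∈ block N n j then (scanState K n c A u s₀ t).toReal i else 0

/-- The matrix of the orthogonal projection of `ℝ^N` (with the Euclidean inner product) onto the
span of a set of vectors. -/
def projMatrix {N : ℕ} (S : Set (Fin N → ℝ)) : Matrix (Fin N) (Fin N) ℝ :=
  Matrix.toEuclideanLin.symm
    (Submodule.span ℝ ((WithLp.toLp 2 : (Fin N → ℝ) → EuclideanSpace ℝ (Fin N)) '' S)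
      ).starProjection.toLinearMap

/-- The projector onto the span of `σ^{s|k}`, `s < m`. So `blockProj … (t + 1) k` is `P^{(t)|k}`,
and `blockProj … 0 k = 0` is `P^{(-1)|k}`. -/
def blockProj {N : ℕ} (K n : ℕ) (c : unitInterval → ℝ → ℤˣ) (A : Matrix (Fin N) (Fin N) ℝ)
    (u : ℕ → Fin N → unitInterval) (s₀ : SpinConfig N) (m k : ℕ) : Matrix (Fin N) (Fin N) ℝ :=
  projMatrix {v | ∃ s < m, v = spinBlock K n c A u s₀ s k}

/-- `P^{(t)}(j) = ∑_{k < j} P^{(t)|k} + ∑_{k ≥ j} P^{(t-1)|k}`, where `k` ranges over the blocks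
`1, …, K`. -/
def scanProj {N : ℕ} (K n : ℕ) (c : unitInterval → ℝ → ℤˣ) (A : Matrix (Fin N) (Fin N) ℝ)
    (u : ℕ → Fin N → unitInterval) (s₀ : SpinConfig N) (t j : ℕ) : Matrix (Fin N) (Fin N) ℝ :=
  ∑ k ∈ Finset.Icc 1 K with k < j, blockProj K n c A u s₀ (t + 1) k +
    ∑ k ∈ Finset.Icc 1 K with j ≤ k, blockProj K n c A u s₀ t k

/-- The set of times `(s, k)`, `k` being one of the blocks `1, …, K`, that strictly precede
`(t, j)` in the lexicographic order. -/
def earlierTimes (K t j : ℕ) : Set (ℕ × ℕ) :=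
  {p | p.2 ∈ Finset.Icc 1 K ∧ (p.1 < t ∨ (p.1 = t ∧ p.2 < j))}

/-- The `σ`-algebra `F_j^t` generated by `σ^0` and by the products `J σ^{s|k}` for
`(s, k) < (t, j)`. -/
abbrev scanFiltration {Ω : Type*} {N : ℕ} (K n : ℕ) (c : unitInterval → ℝ → ℤˣ)
    (J : Ω → Matrix (Fin N) (Fin N) ℝ) (U : Ω → ℕ → Fin N → unitInterval)
    (σ₀ : Ω → SpinConfig N) (t j : ℕ) : MeasurableSpace Ω :=
  MeasurableSpace.comap σ₀ inferInstance ⊔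
    ⨆ p ∈ earlierTimes K t j, MeasurableSpace.comap
      (fun ω => (J ω).mulVec (spinBlock K n c (J ω) (U ω) (σ₀ ω) p.1 p.2)) inferInstance

end

/-!
Fix a seed realization, an initial configuration and a time. The part `J * P` of the disorder
determines the scan up to that time, hence the projector `P` itself. For a deterministic projector,
the two components of a GOE matrix in the corner `(1 - P) J (1 - P)` and in its Frobenius-orthogonal
complement are independent, so replacing the corner by that of an independent copy preserves the
law. This survives for the random projector: revealing one more block enlarges `P` to some `Q`
determined by `J * P`, and resampling along `Q` after having resampled along `P` amounts to
resampling once along `P`, from a fresh matrix which was itself resampled along `Q`. Iterating over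
the times, `J` and the resampled matrix have the same law jointly with `σ⁰` and the seeds; they
share `J * P`, and every `σ`-algebra in the theorem is generated by functions of `σ⁰`, the seeds and
`J * P`.
-/

section Compression

variable {R : Type*} [Ring R] {p q : R}

/-- The compression `a ↦ (1 - p) a (1 - p)` of a ring element to the kernel of a projector `p`. -/
def compress (p : R) : R →+ R :=
  (AddMonoidHom.mulLeft (1 - p)).comp (AddMonoidHom.mulRight (1 - p))

theorem compress_apply (p a : R) : compress p a = (1 - p) * a * (1 - p) :=
  (mul_assoc _ _ _).symm

theorem compress_compress (hpq : p * q = p) (hqp : q * p = p) (a : R) :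
    compress p (compress q a) = compress q a := by
  have hl : (1 - p) * (1 - q) = 1 - q := by rw [one_sub_mul, mul_one_sub, hpq, sub_self, sub_zero]
  have hr : (1 - q) * (1 - p) = 1 - q := by rw [mul_one_sub, one_sub_mul, hqp, sub_self, sub_zero]
  simp only [compress_apply, mul_assoc, hr]
  simp only [← mul_assoc, hl]

theorem compress_compress' (hpq : p * q = p) (hqp : q * p = p) (a : R) :
    compress q (compress p a) = compress q a := by
  have hl : (1 - q) * (1 - p) = 1 - q := by rw [mul_one_sub, one_sub_mul, hqp, sub_self, sub_zero]
  have hr : (1 - p) * (1 - q) = 1 - q := by rw [one_sub_mul, mul_one_sub, hpq, sub_self, sub_zero]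
  simp only [compress_apply, mul_assoc, hr]
  simp only [← mul_assoc, hl]

/-- The element `a` with its compression to the kernel of the projector `p` replaced by that
of `a'`. -/
def resample (p a a' : R) : R := a + compress p (a' - a)

theorem resample_eq (p a a' : R) :
    resample p a a' = (1 - p) * a' * (1 - p) + a * p + p * a * (1 - p) := by
  rw [resample, compress_apply]
  noncomm_ring

theorem resample_zero (a a' : R) : resample 0 a a' = a' := by
  simp [resample, compress_apply]

theorem resample_mul_self (hp : IsIdempotentElem p) (a a' : R) :
    resample p a a' * p = a * p := by
  rw [resample, compress_apply, add_mul, mul_assoc _ (1 - p), hp.one_sub_mul_self, mul_zero,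
    add_zero]

theorem compress_resample (hp : IsIdempotentElem p) (a a' : R) :
    compress p (resample p a a') = compress p a' := by
  rw [resample, map_add, compress_compress hp hp, map_sub, add_sub_cancel]

theorem resample_resample (hpq : p * q = p) (hqp : q * p = p) (a a' a'' : R) :
    resample p a (resample q a' a'') = resample q (resample p a a') a'' := by
  simp only [resample, map_add, map_sub, compress_compress hpq hqp, compress_compress' hpq hqp]
  abel

theorem continuous_compress [TopologicalSpace R] [IsTopologicalRing R] :
    Continuous fun x : R × R => compress x.1 x.2 := by
  simp only [compress_apply]
  fun_prop

theorem continuous_resample [TopologicalSpace R] [IsTopologicalRing R] :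
    Continuous fun x : R × R × R => resample x.1 x.2.1 x.2.2 :=
  continuous_snd.fst.add
    (continuous_compress.comp (continuous_fst.prodMk (by fun_prop)))

end Compression

section Trace

open Matrix

variable {n R : Type*} [Fintype n] [CommRing R]

/-- The quadratic form `S ↦ N * Var ⟨S, J⟩` of a `GOE(N)` matrix `J`, where `⟨S, A⟩ = tr (Sᵀ A)`
is the Frobenius inner product. -/
def goeForm (S : Matrix n n R) : R := (Sᵀ * S).trace + (S * S).trace

theorem trace_transpose_mul_eq_sum (S A : Matrix n n R) :
    (Sᵀ * A).trace = ∑ p : n × n, S p.1 p.2 * A p.1 p.2 := by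
  rw [← vec_dotProduct_vec, dotProduct, ← (Equiv.prodComm n n).sum_comp]
  rfl

theorem goeForm_eq_sum (S : Matrix n n R) :
    goeForm S = ∑ p : n × n, S p.1 p.2 * (S p.1 p.2 + S p.2 p.1) := by
  have h : (S * S).trace = ∑ p : n × n, S p.1 p.2 * S p.2 p.1 := by
    rw [trace_mul_comm, ← trace_transpose, transpose_mul, trace_transpose_mul_eq_sum]
    rfl
  simp only [goeForm, trace_transpose_mul_eq_sum, h, mul_add, Finset.sum_add_distrib]

variable [DecidableEq n] {Q : Matrix n n R}

theorem transpose_compress (hQ : Q.IsSymm) (A : Matrix n n R) :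
    (compress Q A)ᵀ = compress Q Aᵀ := by
  simp only [compress_apply, transpose_mul, transpose_sub, transpose_one, hQ.eq, mul_assoc]

theorem trace_transpose_mul_compress (hQ : Q.IsSymm) (S A : Matrix n n R) :
    (Sᵀ * compress Q A).trace = ((compress Q S)ᵀ * A).trace := by
  rw [transpose_compress hQ, compress_apply, compress_apply, ← mul_assoc, trace_mul_comm]
  simp only [mul_assoc]

theorem trace_transpose_mul_resample (hQ : Q.IsSymm) (S A A' : Matrix n n R) :
    (Sᵀ * resample Q A A').trace =
      ((S - compress Q S)ᵀ * A).trace + ((compress Q S)ᵀ * A').trace := by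
  rw [resample, mul_add, trace_add, trace_transpose_mul_compress hQ, mul_sub, transpose_sub,
    sub_mul, trace_sub, trace_sub]
  ring

theorem trace_transpose_mul_eq_add_compress (hQ : Q.IsSymm) (hQi : IsIdempotentElem Q)
    (S T : Matrix n n R) :
    (Sᵀ * T).trace = ((S - compress Q S)ᵀ * (T - compress Q T)).trace +
      ((compress Q S)ᵀ * compress Q T).trace := by
  have h := trace_transpose_mul_resample hQ S (T - compress Q T) (compress Q T)
  rwa [resample, map_sub, map_sub, compress_compress hQi hQi, sub_self, sub_zero,
    sub_add_cancel] at h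

theorem goeForm_eq_add_compress (hQ : Q.IsSymm) (hQi : IsIdempotentElem Q) (S : Matrix n n R) :
    goeForm S = goeForm (S - compress Q S) + goeForm (compress Q S) := by
  have h := trace_transpose_mul_eq_add_compress hQ hQi Sᵀ S
  simp only [← transpose_compress hQ, ← transpose_sub, transpose_transpose] at h
  rw [goeForm, h, trace_transpose_mul_eq_add_compress hQ hQi, goeForm, goeForm]
  ring

end Trace

section MatrixMeasure

open Matrix

instance {m n : Type*} [Finite m] [Finite n] : BorelSpace (Matrix m n ℝ) :=
  inferInstanceAs (BorelSpace (m → n → ℝ))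

instance {m n : Type*} [Finite m] [Finite n] : SecondCountableTopology (Matrix m n ℝ) :=
  inferInstanceAs (SecondCountableTopology (m → n → ℝ))

variable {n : Type*} [Fintype n]

theorem measurable_trace_transpose_mul (S : Matrix n n ℝ) :
    Measurable fun A : Matrix n n ℝ => (Sᵀ * A).trace :=
  (Continuous.matrix_trace (by fun_prop)).measurable

theorem measurable_compress [DecidableEq n] :
    Measurable fun x : Matrix n n ℝ × Matrix n n ℝ => compress x.1 x.2 :=
  continuous_compress.measurable

theorem measurable_resample [DecidableEq n] :
    Measurable fun x : Matrix n n ℝ × Matrix n n ℝ × Matrix n n ℝ =>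
      resample x.1 x.2.1 x.2.2 :=
  continuous_resample.measurable

theorem measure_ext_of_map_dual {E : Type*} [NormedAddCommGroup E] [NormedSpace ℝ E]
    [CompleteSpace E] [SecondCountableTopology E] [MeasurableSpace E] [BorelSpace E]
    {γ γ' : Measure E} [IsFiniteMeasure γ] [IsFiniteMeasure γ']
    (h : ∀ L : StrongDual ℝ E, γ.map L = γ'.map L) : γ = γ' :=
  Measure.ext_of_charFunDual <| funext fun L => by
    rw [charFunDual_eq_charFun_map_one, charFunDual_eq_charFun_map_one, h]

theorem dual_apply_uncurry [DecidableEq n] (L : StrongDual ℝ (n × n → ℝ)) (A : Matrix n n ℝ) :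
    L (Function.uncurry A) = ((of fun i j => L (Pi.single (i, j) 1))ᵀ * A).trace := by
  rw [trace_transpose_mul_eq_sum, ← ContinuousLinearMap.coe_coe,
    LinearMap.pi_apply_eq_sum_univ (L : (n × n → ℝ) →ₗ[ℝ] ℝ)]
  refine Finset.sum_congr rfl fun p _ => ?_
  rw [smul_eq_mul, mul_comm]
  refine congrArg (fun v => L v * A p.1 p.2) (funext fun q => ?_)
  rw [Pi.single_apply]
  exact if_congr eq_comm rfl rfl

theorem map_eq_of_map_trace_eq {Ω Ω' : Type*} {mΩ : MeasurableSpace Ω} {mΩ' : MeasurableSpace Ω'}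
    {μ : Measure Ω} {ν : Measure Ω'} [IsFiniteMeasure μ] [IsFiniteMeasure ν]
    {X : Ω → Matrix n n ℝ} {Y : Ω' → Matrix n n ℝ} (hX : AEMeasurable X μ) (hY : AEMeasurable Y ν)
    (h : ∀ S : Matrix n n ℝ,
      μ.map (fun ω => (Sᵀ * X ω).trace) = ν.map (fun ω => (Sᵀ * Y ω).trace)) :
    μ.map X = ν.map Y := by
  classical
  let e : Matrix n n ℝ ≃ᵐ (n × n → ℝ) := (MeasurableEquiv.curry n n ℝ).symm
  refine e.map_measurableEquiv_injective (measure_ext_of_map_dual fun L => ?_)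
  rw [AEMeasurable.map_map_of_aemeasurable e.measurable.aemeasurable hX,
    AEMeasurable.map_map_of_aemeasurable e.measurable.aemeasurable hY,
    AEMeasurable.map_map_of_aemeasurable L.measurable.aemeasurable
      (e.measurable.comp_aemeasurable hX),
    AEMeasurable.map_map_of_aemeasurable L.measurable.aemeasurable
      (e.measurable.comp_aemeasurable hY)]
  have hL (A : Matrix n n ℝ) : L (e A) = _ := dual_apply_uncurry L A
  simpa only [Function.comp_def, hL] using h _

end MatrixMeasure

namespace IsGOE

open Matrix

variable {Ω : Type*} {mΩ : MeasurableSpace Ω} {μ : Measure Ω} {N : ℕ}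
  {J J' : Ω → Matrix (Fin N) (Fin N) ℝ}

theorem aemeasurable (hJ : IsGOE J μ) : AEMeasurable J μ :=
  (MeasurableEquiv.curry (Fin N) (Fin N) ℝ).measurable.comp_aemeasurable
    hJ.hasGaussianLaw.aemeasurable

theorem memLp_apply (hJ : IsGOE J μ) (i j : Fin N) : MemLp (fun ω => J ω i j) 2 μ :=
  (hJ.hasGaussianLaw.eval (i, j)).memLp_two

theorem integral_trace (hJ : IsGOE J μ) (S : Matrix (Fin N) (Fin N) ℝ) :
    ∫ ω, (Sᵀ * J ω).trace ∂μ = 0 := by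
  have := hJ.hasGaussianLaw.isProbabilityMeasure
  simp only [trace_transpose_mul_eq_sum]
  rw [integral_finsetSum _ fun p _ =>
    ((hJ.memLp_apply p.1 p.2).integrable one_le_two).const_mul _]
  simp only [integral_const_mul, hJ.mean_zero, mul_zero, Finset.sum_const_zero]

theorem covariance_apply (hJ : IsGOE J μ) (p q : Fin N × Fin N) :
    cov[fun ω => J ω p.1 p.2, fun ω => J ω q.1 q.2; μ] =
      ((if q = p then 1 else 0) + (if q = p.swap then 1 else 0)) / N := by
  have := hJ.hasGaussianLaw.isProbabilityMeasure
  rw [covariance_eq_sub (hJ.memLp_apply _ _) (hJ.memLp_apply _ _), hJ.mean_zero, zero_mul, sub_zero]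
  simp only [Pi.mul_apply, hJ.covariance_eq, Prod.ext_iff, Prod.fst_swap, Prod.snd_swap,
    eq_comm, and_comm]

theorem variance_trace (hJ : IsGOE J μ) (S : Matrix (Fin N) (Fin N) ℝ) :
    Var[fun ω => (Sᵀ * J ω).trace; μ] = goeForm S / N := by
  have := hJ.hasGaussianLaw.isProbabilityMeasure
  have hm (p : Fin N × Fin N) : MemLp (fun ω => S p.1 p.2 * J ω p.1 p.2) 2 μ :=
    (hJ.memLp_apply p.1 p.2).const_mul _
  simp only [trace_transpose_mul_eq_sum]
  rw [variance_fun_sum hm, goeForm_eq_sum, Finset.sum_div]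
  refine Finset.sum_congr rfl fun p _ => ?_
  simp only [covariance_const_mul_left, covariance_const_mul_right, hJ.covariance_apply, add_div,
    mul_add, Finset.sum_add_distrib, ite_div, zero_div, mul_ite, mul_zero, Finset.sum_ite_eq',
    Finset.mem_univ, if_true, Prod.fst_swap, Prod.snd_swap]
  ring

theorem map_trace (hJ : IsGOE J μ) (S : Matrix (Fin N) (Fin N) ℝ) :
    μ.map (fun ω => (Sᵀ * J ω).trace) = gaussianReal 0 (goeForm S / N).toNNReal := by
  have hG : HasGaussianLaw (fun ω => (Sᵀ * J ω).trace) μ := by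
    simpa [trace_transpose_mul_eq_sum] using hJ.hasGaussianLaw.map_fun
      (∑ p, S p.1 p.2 • ContinuousLinearMap.proj (R := ℝ) (φ := fun _ : Fin N × Fin N => ℝ) p)
  rw [hG.map_eq_gaussianReal, hJ.integral_trace, hJ.variance_trace]

theorem map_eq (hJ : IsGOE J μ) (hJ' : IsGOE J' μ) : μ.map J = μ.map J' := by
  have := hJ.hasGaussianLaw.isProbabilityMeasure
  exact map_eq_of_map_trace_eq hJ.aemeasurable hJ'.aemeasurable fun S =>
    (hJ.map_trace S).trans (hJ'.map_trace S).symm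

theorem map_resample (hJ : IsGOE J μ) (hJ' : IsGOE J' μ) (h : IndepFun J J' μ)
    {Q : Matrix (Fin N) (Fin N) ℝ} (hQ : IsStarProjection Q) :
    μ.map (fun ω => resample Q (J ω) (J' ω)) = μ.map J := by
  have := hJ.hasGaussianLaw.isProbabilityMeasure
  have hQs : Q.IsSymm := isHermitian_iff_isSymm.1 hQ.isSelfAdjoint
  have hm : AEMeasurable (fun ω => resample Q (J ω) (J' ω)) μ :=
    measurable_resample.comp_aemeasurable
      (aemeasurable_const.prodMk (hJ.aemeasurable.prodMk hJ'.aemeasurable))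
  have hnonneg (S : Matrix (Fin N) (Fin N) ℝ) : 0 ≤ goeForm S / N :=
    hJ.variance_trace S ▸ variance_nonneg _ _
  have hadd (S : Matrix (Fin N) (Fin N) ℝ) : (goeForm S / N).toNNReal =
      (goeForm (S - compress Q S) / N).toNNReal + (goeForm (compress Q S) / N).toNNReal := by
    rw [← Real.toNNReal_add (hnonneg _) (hnonneg _), ← add_div,
      ← goeForm_eq_add_compress hQs hQ.isIdempotentElem]
  refine map_eq_of_map_trace_eq hm hJ.aemeasurable fun S => ?_
  simp only [trace_transpose_mul_resample hQs]
  rw [hJ.map_trace, hadd, ← add_zero (0 : ℝ)]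
  exact gaussianReal_add_gaussianReal_of_indepFun (h.comp (measurable_trace_transpose_mul _)
    (measurable_trace_transpose_mul _)) (hJ.map_trace _) (hJ'.map_trace _)

theorem measurePreserving_resample (hJ : IsGOE J μ) (hJ' : IsGOE J' μ) (h : IndepFun J J' μ)
    {Q : Matrix (Fin N) (Fin N) ℝ} (hQ : IsStarProjection Q) :
    MeasurePreserving (fun x => resample Q x.1 x.2) ((μ.map J).prod (μ.map J)) (μ.map J) := by
  have := hJ.hasGaussianLaw.isProbabilityMeasure
  have hm : Measurable fun x : Matrix (Fin N) (Fin N) ℝ × _ => resample Q x.1 x.2 :=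
    measurable_resample.comp measurable_prodMk_left
  have hprod := (indepFun_iff_map_prod_eq_prod_map_map hJ.aemeasurable hJ'.aemeasurable).1 h
  refine ⟨hm, ?_⟩
  rw [← hJ.map_eq hJ'] at hprod
  rw [← hprod, AEMeasurable.map_map_of_aemeasurable hm.aemeasurable
    (hJ.aemeasurable.prodMk hJ'.aemeasurable)]
  exact hJ.map_resample hJ' h hQ

end IsGOE

section Projection

theorem starProjection_biSup_eq_sum {𝕜 E ι : Type*} [RCLike 𝕜] [NormedAddCommGroup E]
    [InnerProductSpace 𝕜 E] {V : ι → Submodule 𝕜 E} [∀ k, (V k).HasOrthogonalProjection]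
    {F : Finset ι} [(⨆ k ∈ F, V k).HasOrthogonalProjection]
    (hV : (F : Set ι).Pairwise fun k l => V k ⟂ V l) :
    (⨆ k ∈ F, V k).starProjection = ∑ k ∈ F, (V k).starProjection := by
  classical
  ext x
  rw [sum_apply]
  refine Submodule.eq_starProjection_of_mem_orthogonal
    (Submodule.sum_mem _ fun k hk => Submodule.mem_iSup_of_mem k <|
      Submodule.mem_iSup_of_mem hk (Submodule.starProjection_apply_mem _ x)) ?_
  refine (Submodule.span_singleton_le_iff_mem _ _).1 <|
    Submodule.isOrtho_iSup_right.2 fun k => Submodule.isOrtho_iSup_right.2 fun hk =>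
      (Submodule.span_singleton_le_iff_mem _ _).2 ?_
  rw [← Finset.add_sum_erase F _ hk, ← sub_sub]
  refine Submodule.sub_mem _ (Submodule.sub_starProjection_mem_orthogonal x)
    (Submodule.sum_mem _ fun l hl => ?_)
  obtain ⟨hlk, hl⟩ := Finset.mem_erase.1 hl
  exact (hV hl hk hlk) (Submodule.starProjection_apply_mem _ x)

variable {N : ℕ} {S T : Set (Fin N → ℝ)}

/-- The span of a set of vectors, as a subspace of Euclidean space. -/
abbrev euclideanSpan (S : Set (Fin N → ℝ)) : Submodule ℝ (EuclideanSpace ℝ (Fin N)) :=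
  Submodule.span ℝ ((WithLp.toLp 2 : (Fin N → ℝ) → EuclideanSpace ℝ (Fin N)) '' S)

theorem projMatrix_eq (S : Set (Fin N → ℝ)) :
    projMatrix S =
      (Matrix.toEuclideanCLM (n := Fin N) (𝕜 := ℝ)).symm (euclideanSpan S).starProjection :=
  rfl

theorem isStarProjection_projMatrix (S : Set (Fin N → ℝ)) : IsStarProjection (projMatrix S) where
  isIdempotentElem := isStarProjection_starProjection.isIdempotentElem.map
    (Matrix.toEuclideanCLM (n := Fin N) (𝕜 := ℝ)).symm
  isSelfAdjoint := (map_star (Matrix.toEuclideanCLM (n := Fin N) (𝕜 := ℝ)).symm _).symm.trans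
    (congrArg _ isStarProjection_starProjection.isSelfAdjoint.star_eq)

theorem projMatrix_mul_of_subset (h : S ⊆ T) : projMatrix S * projMatrix T = projMatrix S := by
  rw [projMatrix_eq, projMatrix_eq, ← map_mul]
  exact congrArg _ (Submodule.starProjection_comp_starProjection_of_le
    (Submodule.span_mono (Set.image_mono h)))

theorem projMatrix_mul_of_superset (h : S ⊆ T) : projMatrix T * projMatrix S = projMatrix S := by
  rw [← (isStarProjection_projMatrix T).isSelfAdjoint.star_eq,
    ← (isStarProjection_projMatrix S).isSelfAdjoint.star_eq, ← star_mul,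
    projMatrix_mul_of_subset h]

theorem projMatrix_mulVec_of_mem {v : Fin N → ℝ} (hv : v ∈ S) : (projMatrix S).mulVec v = v := by
  apply WithLp.toLp_injective 2
  rw [projMatrix_eq, ← Matrix.toEuclideanCLM_toLp, StarAlgEquiv.apply_symm_apply]
  exact Submodule.starProjection_eq_self_iff.2 (Submodule.subset_span ⟨v, hv, rfl⟩)

theorem projMatrix_empty : projMatrix (∅ : Set (Fin N → ℝ)) = 0 := by
  simp [projMatrix]

theorem projMatrix_biUnion {ι : Type*} {F : Finset ι} {S : ι → Set (Fin N → ℝ)}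
    (hS : ∀ k ∈ F, ∀ l ∈ F, k ≠ l → ∀ v ∈ S k, ∀ w ∈ S l, dotProduct v w = 0) :
    projMatrix (⋃ k ∈ F, S k) = ∑ k ∈ F, projMatrix (S k) := by
  have hspan : euclideanSpan (⋃ k ∈ F, S k) = ⨆ k ∈ F, euclideanSpan (S k) := by
    simp only [euclideanSpan, Set.image_iUnion, Submodule.span_iUnion]
  have horth : (F : Set ι).Pairwise fun k l => euclideanSpan (S k) ⟂ euclideanSpan (S l) := by
    intro k hk l hl hkl
    rw [Submodule.isOrtho_span]
    rintro _ ⟨v, hv, rfl⟩ _ ⟨w, hw, rfl⟩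
    simpa [EuclideanSpace.inner_eq_star_dotProduct, dotProduct_comm]
      using hS k hk l hl hkl v hv w hw
  simp only [projMatrix_eq, ← map_sum]
  rw [hspan, starProjection_biSup_eq_sum horth, map_sum]

end Projection

section Adaptive

variable {n α : Type*} [Fintype n]

/-- The statistic `f` of a matrix `A` depends only on the part `A * P A` of `A` that is revealed by
the projector `P A`. -/
def RevealedBy (P : Matrix n n ℝ → Matrix n n ℝ) (f : Matrix n n ℝ → α) : Prop :=
  ∀ ⦃A X⦄, X * P A = A * P A → f X = f A

variable [DecidableEq n] {γ : Measure (Matrix n n ℝ)} [IsProbabilityMeasure γ]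
  {P Q : Matrix n n ℝ → Matrix n n ℝ}

theorem RevealedBy.apply_resample {f : Matrix n n ℝ → α} (h : RevealedBy P f)
    (hP : ∀ A, IsIdempotentElem (P A)) (A A' : Matrix n n ℝ) :
    f (resample (P A) A A') = f A :=
  h (resample_mul_self (hP A) A A')

variable (γ) in
theorem measurePreserving_resample_zero :
    MeasurePreserving (fun x : Matrix n n ℝ × Matrix n n ℝ => resample 0 x.1 x.2)
      (γ.prod γ) γ := by
  simpa only [resample_zero] using measurePreserving_snd

theorem measurePreserving_prodMk_resample {E : Type*} [MeasurableSpace E] {ν : Measure E}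
    [SFinite ν] {R : E → Matrix n n ℝ → Matrix n n ℝ} (hR : Measurable (Function.uncurry R))
    (h : ∀ w, MeasurePreserving (fun x => resample (R w x.1) x.1 x.2) (γ.prod γ) γ) :
    MeasurePreserving (fun x : E × Matrix n n ℝ × Matrix n n ℝ =>
      (x.1, resample (R x.1 x.2.1) x.2.1 x.2.2)) (ν.prod (γ.prod γ)) (ν.prod γ) :=
  have hm : Measurable fun x : E × Matrix n n ℝ × Matrix n n ℝ =>
      resample (R x.1 x.2.1) x.2.1 x.2.2 :=
    measurable_resample.comp
      ((hR.comp (measurable_fst.prodMk measurable_snd.fst)).prodMk measurable_snd)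
  (MeasurePreserving.id ν).skew_product
    (g := fun w (x : Matrix n n ℝ × Matrix n n ℝ) => resample (R w x.1) x.1 x.2) hm
    (.of_forall fun w => (h w).map_eq)

/-- Resampling first along `P` and then along the larger `Q` amounts to resampling along `P` with
a fresh matrix which has itself been resampled along `Q A`, a projector independent of it. -/
theorem measurePreserving_resample_of_revealedBy
    (hγ : ∀ R, IsStarProjection R → MeasurePreserving (fun x => resample R x.1 x.2) (γ.prod γ) γ)
    (hQm : Measurable Q) (hP : ∀ A, IsIdempotentElem (P A))
    (hQ : ∀ A, IsStarProjection (Q A)) (hPQ : ∀ A, P A * Q A = P A)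
    (hQP : ∀ A, Q A * P A = P A) (hrev : RevealedBy P Q)
    (h : MeasurePreserving (fun x => resample (P x.1) x.1 x.2) (γ.prod γ) γ) :
    MeasurePreserving (fun x => resample (Q x.1) x.1 x.2) (γ.prod γ) γ := by
  have hm : Measurable fun x : Matrix n n ℝ × Matrix n n ℝ => resample (Q x.1) x.1 x.2 :=
    measurable_resample.comp
      ((hQm.comp measurable_fst).prodMk (measurable_fst.prodMk measurable_snd))
  have hfresh := measurePreserving_prodMk_resample (ν := γ) (R := fun A _ => Q A)
    (hQm.comp measurable_fst) fun A => hγ (Q A) (hQ A)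
  have htwice := (h.prod (MeasurePreserving.id γ)).comp (measurePreserving_prodAssoc γ γ γ).symm
  refine ⟨hm, ?_⟩
  conv_lhs => rw [← htwice.map_eq]
  rw [Measure.map_map hm htwice.measurable]
  refine Eq.trans (congrArg (fun f => Measure.map f _) (funext fun x => ?_)) (h.comp hfresh).map_eq
  change resample (Q (resample (P x.1) x.1 x.2.1)) (resample (P x.1) x.1 x.2.1) x.2.2 =
    resample (P x.1) x.1 (resample (Q x.1) x.2.1 x.2.2)
  rw [hrev.apply_resample hP, resample_resample (hPQ _) (hQP _)]

end Adaptive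

section ConditionalLaw

namespace CondIdentDistrib

variable {Ω E E₁ E₂ : Type*} {m mΩ : MeasurableSpace Ω} [MeasurableSpace E] [MeasurableSpace E₁]
  [MeasurableSpace E₂] {μ : Measure Ω} [IsFiniteMeasure μ]

theorem of_measure_inter_eq (hm : m ≤ mΩ) {X Y : Ω → E} (hX : Measurable X) (hY : Measurable Y)
    (h : ∀ B, MeasurableSet B → ∀ S, MeasurableSet[m] S → μ (X ⁻¹' B ∩ S) = μ (Y ⁻¹' B ∩ S)) :
    CondIdentDistrib μ m X Y := by
  refine ⟨hm, hX.aemeasurable, hY.aemeasurable, fun B hB => ?_⟩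
  have hint (Z : Ω → E) (hZ : Measurable Z) :
      Integrable ((Z ⁻¹' B).indicator fun _ => (1 : ℝ)) μ :=
    (integrable_const 1).indicator (hZ hB)
  refine ae_eq_condExp_of_forall_setIntegral_eq hm (hint Y hY)
    (fun _ _ _ => integrable_condExp.integrableOn) (fun S hS _ => ?_)
    stronglyMeasurable_condExp.aestronglyMeasurable
  rw [setIntegral_condExp hm (hint X hX) hS, setIntegral_indicator (hX hB),
    setIntegral_indicator (hY hB)]
  simp only [setIntegral_const, smul_eq_mul, mul_one, measureReal_def]
  rw [Set.inter_comm, h B hB S hS, Set.inter_comm]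

theorem of_map_eq {V V' : Ω → E₁} (hV : Measurable V) (hV' : Measurable V')
    (hmap : μ.map V = μ.map V') {G : E₁ → E₂} (hG : Measurable G)
    (hGV : ∀ ω, G (V' ω) = G (V ω))
    (hm : m ≤ MeasurableSpace.comap (fun ω => G (V ω)) inferInstance)
    {F : E₁ → E} (hF : Measurable F) :
    CondIdentDistrib μ m (fun ω => F (V ω)) (fun ω => F (V' ω)) := by
  refine .of_measure_inter_eq (hm.trans (hG.comp hV).comap_le) (hF.comp hV) (hF.comp hV') ?_
  intro B hB S hS
  obtain ⟨C, hC, rfl⟩ := hm _ hS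
  have hFG : MeasurableSet (F ⁻¹' B ∩ G ⁻¹' C) := (hF hB).inter (hG hC)
  calc μ ((fun ω => F (V ω)) ⁻¹' B ∩ (fun ω => G (V ω)) ⁻¹' C)
    _ = μ.map V (F ⁻¹' B ∩ G ⁻¹' C) := (Measure.map_apply hV hFG).symm
    _ = μ (V' ⁻¹' (F ⁻¹' B ∩ G ⁻¹' C)) := by rw [hmap, Measure.map_apply hV' hFG]
    _ = μ ((fun ω => F (V' ω)) ⁻¹' B ∩ (fun ω => G (V ω)) ⁻¹' C) := by
      simp only [← hGV]
      rfl

end CondIdentDistrib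

theorem measurePreserving_prodMk_prodMk {Ω E F : Type*} {mΩ : MeasurableSpace Ω}
    [MeasurableSpace E] [MeasurableSpace F] {μ : Measure Ω} [IsFiniteMeasure μ] {W : Ω → E}
    {X Y : Ω → F} (hW : Measurable W) (hX : Measurable X) (hY : Measurable Y)
    (hlaw : μ.map Y = μ.map X) (hXW : IndepFun X W μ)
    (hYXW : IndepFun Y (fun ω => (X ω, W ω)) μ) :
    MeasurePreserving (fun ω => (W ω, X ω, Y ω)) μ
      ((μ.map W).prod ((μ.map X).prod (μ.map X))) := by
  have hWX : MeasurePreserving (fun ω => (W ω, X ω)) μ ((μ.map W).prod (μ.map X)) :=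
    ⟨hW.prodMk hX, hXW.symm.map_prod_eq_prod_map_map hW.aemeasurable hX.aemeasurable⟩
  have hWXY : MeasurePreserving (fun ω => ((W ω, X ω), Y ω)) μ
      (((μ.map W).prod (μ.map X)).prod (μ.map X)) := by
    refine ⟨hWX.measurable.prodMk hY, ?_⟩
    rw [(hYXW.comp measurable_id measurable_swap).symm.map_prod_eq_prod_map_map
      hWX.aemeasurable hY.aemeasurable, hlaw, ← hWX.map_eq]
  exact (measurePreserving_prodAssoc _ _ _).comp hWXY

variable {Ω E F n : Type*} {m mΩ : MeasurableSpace Ω} [MeasurableSpace E] [MeasurableSpace F]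
  [Fintype n] [DecidableEq n] {μ : Measure Ω} [IsFiniteMeasure μ] {ν : Measure E} [SFinite ν]
  {γ : Measure (Matrix n n ℝ)} [IsProbabilityMeasure γ] {W : Ω → E} {J Jt : Ω → Matrix n n ℝ}
  {P : E → Matrix n n ℝ → Matrix n n ℝ}

theorem condIdentDistrib_resample
    (h : MeasurePreserving (fun ω => (W ω, J ω, Jt ω)) μ (ν.prod (γ.prod γ)))
    (hPm : Measurable (Function.uncurry P)) (hP : ∀ w A, IsIdempotentElem (P w A))
    (hrev : ∀ w, RevealedBy (P w) (P w))
    (hinv : ∀ w, MeasurePreserving (fun x => resample (P w x.1) x.1 x.2) (γ.prod γ) γ)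
    (hm : m ≤ MeasurableSpace.comap (fun ω => (W ω, J ω * P (W ω) (J ω))) inferInstance)
    {f : E × Matrix n n ℝ → F} (hf : Measurable f) :
    CondIdentDistrib μ m (fun ω => f (W ω, J ω))
      (fun ω => f (W ω, resample (P (W ω) (J ω)) (J ω) (Jt ω))) := by
  have hWJ : MeasurePreserving (fun ω => (W ω, J ω)) μ (ν.prod γ) :=
    ((MeasurePreserving.id ν).prod measurePreserving_fst).comp h
  have hWR : MeasurePreserving
      (fun ω => (W ω, resample (P (W ω) (J ω)) (J ω) (Jt ω))) μ (ν.prod γ) :=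
    (measurePreserving_prodMk_resample hPm hinv).comp h
  refine .of_map_eq hWJ.measurable hWR.measurable (hWJ.map_eq.trans hWR.map_eq.symm)
    (G := fun x => (x.1, x.2 * P x.1 x.2))
    (measurable_fst.prodMk (measurable_mul.comp (measurable_snd.prodMk hPm))) (fun ω => ?_) hm hf
  simp only [(hrev _).apply_resample (hP _), resample_mul_self (hP _ _)]

theorem condIdentDistrib_compress
    (h : MeasurePreserving (fun ω => (W ω, J ω, Jt ω)) μ (ν.prod (γ.prod γ)))
    (hPm : Measurable (Function.uncurry P)) (hP : ∀ w A, IsIdempotentElem (P w A))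
    (hrev : ∀ w, RevealedBy (P w) (P w))
    (hinv : ∀ w, MeasurePreserving (fun x => resample (P w x.1) x.1 x.2) (γ.prod γ) γ)
    (hm : m ≤ MeasurableSpace.comap (fun ω => (W ω, J ω * P (W ω) (J ω))) inferInstance) :
    CondIdentDistrib μ m (fun ω => compress (P (W ω) (J ω)) (J ω))
      (fun ω => compress (P (W ω) (J ω)) (Jt ω)) := by
  have hf : Measurable fun x : E × Matrix n n ℝ => compress (P x.1 x.2) x.2 :=
    measurable_compress.comp (f := fun x : E × Matrix n n ℝ => (P x.1 x.2, x.2))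
      (hPm.prodMk measurable_snd)
  have hcompress (ω : Ω) : compress (P (W ω) (J ω)) (Jt ω) =
      compress (P (W ω) (resample (P (W ω) (J ω)) (J ω) (Jt ω)))
        (resample (P (W ω) (J ω)) (J ω) (Jt ω)) := by
    rw [(hrev _).apply_resample (hP _), compress_resample (hP _ _)]
  have hlaw := condIdentDistrib_resample h hPm hP hrev hinv hm hf
  simpa only [hcompress] using hlaw

end ConditionalLaw

section Blocks

variable {N K n : ℕ}

theorem block_unique {k l : ℕ} {i : Fin N} (hk : i ∈ block N n k) (hl : i ∈ block N n l) :
    k = l := by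
  have hle {a b : ℕ} (ha : i ∈ block N n a) (hb : i ∈ block N n b) : a ≤ b := by
    simp only [block, Set.mem_ofPred_eq] at ha hb
    by_contra! hba
    have := Nat.mul_le_mul_right n hba
    rw [Nat.succ_mul] at this
    omega
  exact (hle hk hl).antisymm (hle hl hk)

theorem exists_mem_block (hN : N ≤ K * n) (i : Fin N) :
    ∃ k ∈ Finset.Icc 1 K, i ∈ block N n k := by
  have hi : (i : ℕ) < K * n := i.2.trans_le hN
  have hn : 0 < n := Nat.pos_of_mul_pos_left (Nat.zero_lt_of_lt hi)
  have hlt : (i : ℕ) / n < K := (Nat.div_lt_iff_lt_mul hn).2 hi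
  have hdiv_le := Nat.div_mul_le_self (i : ℕ) n
  have hlt_div := Nat.lt_div_mul_add (a := (i : ℕ)) hn
  generalize (i : ℕ) / n = q at hlt hdiv_le hlt_div
  refine ⟨q + 1, Finset.mem_Icc.2 ⟨by omega, by omega⟩, ?_⟩
  simp only [block, Set.mem_ofPred_eq, Nat.succ_mul]
  omega

theorem earlierTimes_zero_zero (K : ℕ) : earlierTimes K 0 0 = ∅ := by
  simp [earlierTimes]

theorem earlierTimes_succ_zero (K t : ℕ) : earlierTimes K (t + 1) 0 = earlierTimes K t (K + 1) := by
  ext p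
  simp only [earlierTimes, Set.mem_ofPred_eq, Finset.mem_Icc]
  omega

theorem earlierTimes_subset_succ (K t j : ℕ) : earlierTimes K t j ⊆ earlierTimes K t (j + 1) := by
  rintro p ⟨hK, hlt⟩
  exact ⟨hK, by omega⟩

theorem earlierTimes_subset_of_mem_succ {t j : ℕ} {p : ℕ × ℕ}
    (hp : p ∈ earlierTimes K t (j + 1)) :
    earlierTimes K p.1 p.2 ⊆ earlierTimes K t j := by
  rintro q ⟨hK, hlt⟩
  have := hp.2
  exact ⟨hK, by omega⟩

end Blocks

section Scan

variable {N K n : ℕ} {c : unitInterval → ℝ → ℤˣ} {A X : Matrix (Fin N) (Fin N) ℝ}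

theorem passState_apply {u : Fin N → unitInterval} {s : SpinConfig N} {k : ℕ} (hk : 1 ≤ k)
    {i : Fin N} (hi : i ∈ block N n k) (m : ℕ) :
    passState n c A u s m i =
      if k ≤ m then c (u i) (A.mulVec (passState n c A u s (k - 1)).toReal i) else s i := by
  induction m with
  | zero =>
    rw [if_neg (by omega)]
    rfl
  | succ m ih =>
    rw [passState, blockUpdate]
    by_cases h : i ∈ block N n (m + 1)
    · obtain rfl := block_unique hi h
      rw [if_pos h, if_pos le_rfl, Nat.add_sub_cancel]
    · have hne : k ≠ m + 1 := fun e => h (e ▸ hi)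
      rw [if_neg h, ih]
      exact if_congr (by omega) rfl rfl

variable {u : ℕ → Fin N → unitInterval} {s₀ : SpinConfig N} {s t j k l : ℕ} {i : Fin N}

theorem scanState_succ_apply (hk : k ∈ Finset.Icc 1 K) (hi : i ∈ block N n k) :
    scanState K n c A u s₀ (t + 1) i = c (u (t + 1) i)
      (A.mulVec (passState n c A (u (t + 1)) (scanState K n c A u s₀ t) (k - 1)).toReal i) := by
  rw [Finset.mem_Icc] at hk
  rw [scanState, passState_apply hk.1 hi, if_pos hk.2]

theorem spinBlock_of_mem (hi : i ∈ block N n k) :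
    spinBlock K n c A u s₀ t k i = (scanState K n c A u s₀ t).toReal i :=
  if_pos hi

theorem spinBlock_of_notMem (hi : i ∉ block N n k) : spinBlock K n c A u s₀ t k i = 0 :=
  if_neg hi

theorem spinBlock_dotProduct_eq_zero (hkl : k ≠ l) :
    dotProduct (spinBlock K n c A u s₀ s k) (spinBlock K n c A u s₀ t l) = 0 := by
  refine Finset.sum_eq_zero fun i _ => ?_
  by_cases hi : i ∈ block N n k
  · rw [spinBlock_of_notMem fun h => hkl (block_unique hi h), mul_zero]
  · rw [spinBlock_of_notMem hi, zero_mul]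

theorem passState_toReal_eq_sum (hN : N ≤ K * n) (hk : k ∈ Finset.Icc 1 K) :
    (passState n c A (u (t + 1)) (scanState K n c A u s₀ t) (k - 1)).toReal =
      ∑ l ∈ Finset.Icc 1 K, spinBlock K n c A u s₀ (if l < k then t + 1 else t) l := by
  funext i
  obtain ⟨l, hl, hi⟩ := exists_mem_block hN i
  have hk1 := (Finset.mem_Icc.1 hk).1
  rw [Finset.sum_apply, Finset.sum_eq_single_of_mem l hl fun m _ hm =>
    spinBlock_of_notMem fun h => hm (block_unique h hi), spinBlock_of_mem hi]
  simp only [SpinConfig.toReal]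
  rw [passState_apply (Finset.mem_Icc.1 hl).1 hi]
  by_cases h : l < k
  · rw [if_pos (by omega), if_pos h, scanState_succ_apply hl hi]
  · rw [if_neg (by omega), if_neg h]

theorem spinBlock_succ_apply (hN : N ≤ K * n) (hk : k ∈ Finset.Icc 1 K) (hi : i ∈ block N n k) :
    spinBlock K n c A u s₀ (t + 1) k i = ((c (u (t + 1) i) (∑ l ∈ Finset.Icc 1 K,
      A.mulVec (spinBlock K n c A u s₀ (if l < k then t + 1 else t) l) i) : ℤ) : ℝ) := by
  rw [spinBlock_of_mem hi, SpinConfig.toReal, scanState_succ_apply hk hi,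
    passState_toReal_eq_sum hN hk, Matrix.mulVec_sum, Finset.sum_apply]

theorem spinBlock_congr (hN : N ≤ K * n) (t k : ℕ) (hk : k ∈ Finset.Icc 1 K)
    (h : ∀ p ∈ earlierTimes K t k, X.mulVec (spinBlock K n c A u s₀ p.1 p.2) =
      A.mulVec (spinBlock K n c A u s₀ p.1 p.2)) :
    spinBlock K n c X u s₀ t k = spinBlock K n c A u s₀ t k := by
  have hearlier : ∀ p ∈ earlierTimes K t k, X.mulVec (spinBlock K n c X u s₀ p.1 p.2) =
      A.mulVec (spinBlock K n c A u s₀ p.1 p.2) := fun p hp => by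
    rw [spinBlock_congr hN p.1 p.2 hp.1 fun q hq =>
      h q (earlierTimes_subset_of_mem_succ (earlierTimes_subset_succ _ _ _ hp) hq), h p hp]
  funext i
  by_cases hi : i ∈ block N n k
  · cases t with
    | zero => rfl
    | succ t =>
      have hfield : ∀ l ∈ Finset.Icc 1 K,
          X.mulVec (spinBlock K n c X u s₀ (if l < k then t + 1 else t) l) i =
            A.mulVec (spinBlock K n c A u s₀ (if l < k then t + 1 else t) l) i := fun l hl =>
        congrFun (hearlier (if l < k then t + 1 else t, l)
          ⟨hl, by dsimp only; split_ifs <;> omega⟩) i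
      rw [spinBlock_succ_apply hN hk hi, spinBlock_succ_apply hN hk hi, Finset.sum_congr rfl hfield]
  · rw [spinBlock_of_notMem hi, spinBlock_of_notMem hi]
termination_by (t, k)
decreasing_by
  rcases hp.2 with hlt | ⟨heq, hlt⟩
  · exact Prod.Lex.left _ _ hlt
  · exact heq ▸ Prod.Lex.right _ hlt

/-- The set of the vectors `σ^{s|k}` for `(s, k) < (t, j)`: those whose products with the matrix
generate `F_j^t`. -/
def revealedBlocks (K n : ℕ) (c : unitInterval → ℝ → ℤˣ) (A : Matrix (Fin N) (Fin N) ℝ)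
    (u : ℕ → Fin N → unitInterval) (s₀ : SpinConfig N) (t j : ℕ) : Set (Fin N → ℝ) :=
  (fun p => spinBlock K n c A u s₀ p.1 p.2) '' earlierTimes K t j

theorem revealedBlocks_subset_succ (K n : ℕ) (c : unitInterval → ℝ → ℤˣ)
    (A : Matrix (Fin N) (Fin N) ℝ) (u : ℕ → Fin N → unitInterval) (s₀ : SpinConfig N) (t j : ℕ) :
    revealedBlocks K n c A u s₀ t j ⊆ revealedBlocks K n c A u s₀ t (j + 1) :=
  Set.image_mono (earlierTimes_subset_succ K t j)

theorem scanProj_eq_projMatrix (K n : ℕ) (c : unitInterval → ℝ → ℤˣ)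
    (A : Matrix (Fin N) (Fin N) ℝ) (u : ℕ → Fin N → unitInterval) (s₀ : SpinConfig N) (t j : ℕ) :
    scanProj K n c A u s₀ t j = projMatrix (revealedBlocks K n c A u s₀ t j) := by
  have hunion : revealedBlocks K n c A u s₀ t j = ⋃ k ∈ Finset.Icc 1 K,
      {v | ∃ s < (if k < j then t + 1 else t), v = spinBlock K n c A u s₀ s k} := by
    ext v
    simp only [revealedBlocks, Set.mem_image, Set.mem_iUnion, Set.mem_ofPred_eq, exists_prop]
    constructor
    · rintro ⟨p, ⟨hp, hlt⟩, rfl⟩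
      exact ⟨p.2, hp, p.1, by split_ifs <;> omega, rfl⟩
    · rintro ⟨k, hk, s, hs, rfl⟩
      exact ⟨(s, k), ⟨hk, by split_ifs at hs <;> grind⟩, rfl⟩
  have hsum : scanProj K n c A u s₀ t j =
      ∑ k ∈ Finset.Icc 1 K, blockProj K n c A u s₀ (if k < j then t + 1 else t) k := by
    rw [scanProj, ← Finset.sum_filter_add_sum_filter_not (Finset.Icc 1 K) (fun k => k < j)]
    simp only [not_lt]
    congr 1 <;> refine Finset.sum_congr rfl fun k hk => ?_
    · rw [if_pos (Finset.mem_filter.1 hk).2]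
    · rw [if_neg (Finset.mem_filter.1 hk).2.not_gt]
  rw [hsum, hunion, projMatrix_biUnion]
  · rfl
  · rintro k _ l _ hkl v ⟨s, _, rfl⟩ w ⟨s', _, rfl⟩
    exact spinBlock_dotProduct_eq_zero hkl

theorem mulVec_eq_of_mul_projMatrix_eq {S : Set (Fin N → ℝ)}
    (h : X * projMatrix S = A * projMatrix S) {v : Fin N → ℝ} (hv : v ∈ S) :
    X.mulVec v = A.mulVec v := by
  simpa only [← Matrix.mulVec_mulVec, projMatrix_mulVec_of_mem hv] using
    congrArg (Matrix.mulVec · v) h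

theorem revealedBy_spinBlock (hN : N ≤ K * n) (c : unitInterval → ℝ → ℤˣ)
    (u : ℕ → Fin N → unitInterval) (s₀ : SpinConfig N) {p : ℕ × ℕ}
    (hp : p ∈ earlierTimes K t (j + 1)) :
    RevealedBy (fun A => projMatrix (revealedBlocks K n c A u s₀ t j))
      fun A => spinBlock K n c A u s₀ p.1 p.2 := fun _ _ h =>
  spinBlock_congr hN p.1 p.2 hp.1 fun _ hq => mulVec_eq_of_mul_projMatrix_eq h
    (Set.mem_image_of_mem _ (earlierTimes_subset_of_mem_succ hp hq))

theorem revealedBy_projMatrix_revealedBlocks (hN : N ≤ K * n) (c : unitInterval → ℝ → ℤˣ)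
    (u : ℕ → Fin N → unitInterval) (s₀ : SpinConfig N) (t j : ℕ) :
    RevealedBy (fun A => projMatrix (revealedBlocks K n c A u s₀ t j))
      fun A => projMatrix (revealedBlocks K n c A u s₀ t j) := fun _ _ h =>
  congrArg projMatrix <| Set.image_congr fun _ hp =>
    revealedBy_spinBlock hN c u s₀ (earlierTimes_subset_succ K t j hp) h

theorem revealedBy_projMatrix_revealedBlocks_succ (hN : N ≤ K * n) (c : unitInterval → ℝ → ℤˣ)
    (u : ℕ → Fin N → unitInterval) (s₀ : SpinConfig N) (t j : ℕ) :
    RevealedBy (fun A => projMatrix (revealedBlocks K n c A u s₀ t j))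
      fun A => projMatrix (revealedBlocks K n c A u s₀ t (j + 1)) := fun _ _ h =>
  congrArg projMatrix <| Set.image_congr fun _ hp => revealedBy_spinBlock hN c u s₀ hp h

end Scan

section ScanMeasurable

theorem measurable_of_factorsThrough {α β γ : Type*} [MeasurableSpace α] [MeasurableSpace β]
    [MeasurableSpace γ] [Countable β] [MeasurableSingletonClass β] {S : α → β} {f : α → γ}
    (hS : Measurable S) (h : f.FactorsThrough S) : Measurable f := by
  intro B _
  have hpre : f ⁻¹' B = S ⁻¹' (S '' (f ⁻¹' B)) := by
    refine (Set.subset_preimage_image _ _).antisymm ?_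
    rintro x ⟨y, hy, hyx⟩
    rwa [Set.mem_preimage, ← h hyx]
  exact hpre ▸ hS (Set.to_countable _).measurableSet

theorem measurable_mulVec {m n : Type*} [Finite m] [Fintype n] :
    Measurable fun x : Matrix m n ℝ × (n → ℝ) => x.1.mulVec x.2 :=
  (Continuous.matrix_mulVec continuous_fst continuous_snd).measurable

instance {M : Type*} [Monoid M] [MeasurableSpace M] [MeasurableSingletonClass M] :
    MeasurableSingletonClass Mˣ where
  measurableSet_singleton u :=
    ⟨{(u : M)}, measurableSet_singleton _, by ext v; simp [Units.ext_iff]⟩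

variable {N : ℕ} {α : Type*} [MeasurableSpace α] {c : unitInterval → ℝ → ℤˣ}
  {A : α → Matrix (Fin N) (Fin N) ℝ}

theorem measurable_blockUpdate (hc : Measurable (Function.uncurry c)) (n j : ℕ)
    {u : α → Fin N → unitInterval} {s : α → SpinConfig N} (hA : Measurable A)
    (hu : Measurable u) (hs : Measurable s) :
    Measurable fun x => blockUpdate n c (A x) (u x) j (s x) := by
  refine measurable_pi_lambda _ fun i => ?_
  unfold blockUpdate
  split_ifs
  · have hreal := (measurable_of_finite SpinConfig.toReal).comp hs
    have hfield := measurable_mulVec.comp (hA.prodMk hreal)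
    exact hc.comp (hu.eval.prodMk hfield.eval)
  · exact hs.eval

theorem measurable_passState (hc : Measurable (Function.uncurry c)) (n : ℕ)
    {u : α → Fin N → unitInterval} {s : α → SpinConfig N} (hA : Measurable A)
    (hu : Measurable u) (hs : Measurable s) (m : ℕ) :
    Measurable fun x => passState n c (A x) (u x) (s x) m := by
  induction m with
  | zero => exact hs
  | succ m ih => exact measurable_blockUpdate hc n (m + 1) hA hu ih

variable {u : α → ℕ → Fin N → unitInterval} {s : α → SpinConfig N}

theorem measurable_scanState (hc : Measurable (Function.uncurry c)) (K n : ℕ) (hA : Measurable A)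
    (hu : Measurable u) (hs : Measurable s) (t : ℕ) :
    Measurable fun x => scanState K n c (A x) (u x) (s x) t := by
  induction t with
  | zero => exact hs
  | succ t ih => exact measurable_passState hc n hA hu.eval ih K

theorem measurable_spinBlock (hc : Measurable (Function.uncurry c)) (K n : ℕ) (hA : Measurable A)
    (hu : Measurable u) (hs : Measurable s) (t k : ℕ) :
    Measurable fun x => spinBlock K n c (A x) (u x) (s x) t k :=
  measurable_of_factorsThrough (measurable_scanState hc K n hA hu hs t) fun x y h => by
    funext i
    simp only [spinBlock, h]

theorem measurable_projMatrix_revealedBlocks (hc : Measurable (Function.uncurry c)) (K n : ℕ)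
    (hA : Measurable A) (hu : Measurable u) (hs : Measurable s) (t j : ℕ) :
    Measurable fun x => projMatrix (revealedBlocks K n c (A x) (u x) (s x) t j) := by
  have hstates : Measurable fun x => fun r : Fin (t + 1) => scanState K n c (A x) (u x) (s x) r :=
    measurable_pi_lambda _ fun r => measurable_scanState hc K n hA hu hs r
  refine measurable_of_factorsThrough hstates fun x y h => ?_
  refine congrArg projMatrix (Set.image_congr fun p hp => ?_)
  have hlt : p.1 < t + 1 := by have := hp.2; omega
  have hstate := congrFun h ⟨p.1, hlt⟩
  funext i
  simp only [spinBlock, hstate]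

end ScanMeasurable

section ScanConditionalLaw

variable {N K n : ℕ} {c : unitInterval → ℝ → ℤˣ}

theorem measurePreserving_resample_revealedBlocks (hN : N ≤ K * n)
    (hc : Measurable (Function.uncurry c)) {γ : Measure (Matrix (Fin N) (Fin N) ℝ)}
    [IsProbabilityMeasure γ]
    (hγ : ∀ R, IsStarProjection R → MeasurePreserving (fun x => resample R x.1 x.2) (γ.prod γ) γ)
    (u : ℕ → Fin N → unitInterval) (s₀ : SpinConfig N) (t j : ℕ) :
    MeasurePreserving
      (fun x => resample (projMatrix (revealedBlocks K n c x.1 u s₀ t j)) x.1 x.2)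
      (γ.prod γ) γ := by
  have hstep (t j : ℕ) (h : MeasurePreserving
      (fun x => resample (projMatrix (revealedBlocks K n c x.1 u s₀ t j)) x.1 x.2)
      (γ.prod γ) γ) : MeasurePreserving
      (fun x => resample (projMatrix (revealedBlocks K n c x.1 u s₀ t (j + 1))) x.1 x.2)
      (γ.prod γ) γ :=
    measurePreserving_resample_of_revealedBy
      (P := fun A => projMatrix (revealedBlocks K n c A u s₀ t j))
      (Q := fun A => projMatrix (revealedBlocks K n c A u s₀ t (j + 1))) hγ
      (measurable_projMatrix_revealedBlocks hc K n (A := fun A => A) measurable_id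
        measurable_const measurable_const t (j + 1))
      (fun _ => (isStarProjection_projMatrix _).isIdempotentElem)
      (fun _ => isStarProjection_projMatrix _)
      (fun A => projMatrix_mul_of_subset (revealedBlocks_subset_succ K n c A u s₀ t j))
      (fun A => projMatrix_mul_of_superset (revealedBlocks_subset_succ K n c A u s₀ t j))
      (revealedBy_projMatrix_revealedBlocks_succ hN c u s₀ t j) h
  induction t generalizing j with
  | zero =>
    induction j with
    | zero =>
      simpa only [revealedBlocks, earlierTimes_zero_zero, Set.image_empty, projMatrix_empty] using
        measurePreserving_resample_zero γ
    | succ j ih => exact hstep 0 j ih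
  | succ t iht =>
    induction j with
    | zero => simpa only [revealedBlocks, earlierTimes_succ_zero] using iht (K + 1)
    | succ j ih => exact hstep (t + 1) j ih

theorem mulVec_spinBlock_mul_projMatrix (hN : N ≤ K * n) (c : unitInterval → ℝ → ℤˣ)
    (A : Matrix (Fin N) (Fin N) ℝ) (u : ℕ → Fin N → unitInterval) (s₀ : SpinConfig N) {t j : ℕ}
    {p : ℕ × ℕ} (hp : p ∈ earlierTimes K t j) :
    letI X := A * projMatrix (revealedBlocks K n c A u s₀ t j)
    X.mulVec (spinBlock K n c X u s₀ p.1 p.2) = A.mulVec (spinBlock K n c A u s₀ p.1 p.2) := by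
  have hX : A * projMatrix (revealedBlocks K n c A u s₀ t j) *
      projMatrix (revealedBlocks K n c A u s₀ t j) =
        A * projMatrix (revealedBlocks K n c A u s₀ t j) := by
    rw [mul_assoc, (isStarProjection_projMatrix _).isIdempotentElem.eq]
  have hblock := revealedBy_spinBlock hN c u s₀ (earlierTimes_subset_succ K t j hp) hX
  dsimp only at hblock
  rw [hblock]
  exact mulVec_eq_of_mul_projMatrix_eq hX (Set.mem_image_of_mem _ hp)

theorem scanFiltration_sup_comap_le (hN : N ≤ K * n) (hc : Measurable (Function.uncurry c))
    {Ω : Type*} (J : Ω → Matrix (Fin N) (Fin N) ℝ) (U : Ω → ℕ → Fin N → unitInterval)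
    (σ₀ : Ω → SpinConfig N) (t j : ℕ) :
    scanFiltration K n c J U σ₀ t j ⊔ MeasurableSpace.comap U inferInstance ≤
      MeasurableSpace.comap (fun ω => ((σ₀ ω, U ω),
        J ω * projMatrix (revealedBlocks K n c (J ω) (U ω) (σ₀ ω) t j))) inferInstance := by
  let obs (ω : Ω) := ((σ₀ ω, U ω), J ω * projMatrix (revealedBlocks K n c (J ω) (U ω) (σ₀ ω) t j))
  let : MeasurableSpace Ω := .comap obs inferInstance
  have h : Measurable obs := comap_measurable obs
  refine sup_le (sup_le h.fst.fst.comap_le (iSup₂_le fun p hp => ?_)) h.fst.snd.comap_le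
  have hmeas := measurable_mulVec.comp
    (h.snd.prodMk (measurable_spinBlock hc K n h.snd h.fst.snd h.fst.fst p.1 p.2))
  simp only [obs, Function.comp_def, mulVec_spinBlock_mul_projMatrix hN c _ _ _ hp] at hmeas
  exact hmeas.comap_le

end ScanConditionalLaw

theorem mainTheorem6_general
    {Ω : Type*} [mΩ : MeasurableSpace Ω] (μ : Measure Ω) [IsProbabilityMeasure μ]
    (N K n : ℕ) (hN : N ≤ K * n)
    (c : unitInterval → ℝ → ℤˣ) (hc : Measurable (Function.uncurry c))
    (J : Ω → Matrix (Fin N) (Fin N) ℝ) (σ₀ : Ω → SpinConfig N)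
    (U : Ω → ℕ → Fin N → unitInterval) (Jt : Ω → Matrix (Fin N) (Fin N) ℝ)
    (hJ_meas : Measurable J) (hσ₀_meas : Measurable σ₀) (hU_meas : Measurable U)
    (hJt_meas : Measurable Jt)
    (hJ : IsGOE J μ) (hJt : IsGOE Jt μ)
    (hJ_indep : IndepFun J (fun ω => (σ₀ ω, U ω)) μ)
    (hJt_indep : IndepFun Jt (fun ω => (J ω, σ₀ ω, U ω)) μ)
    (t j : ℕ)
    (P : Ω → Matrix (Fin N) (Fin N) ℝ)
    (hP : ∀ ω, P ω = scanProj K n c (J ω) (U ω) (σ₀ ω) t j) :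
    (∀ ω, P ω = projMatrix
      ((fun p => spinBlock K n c (J ω) (U ω) (σ₀ ω) p.1 p.2) '' earlierTimes K t j)) ∧
    (∀ H : MeasurableSpace Ω,
      H ≤ scanFiltration K n c J U σ₀ t j ⊔ MeasurableSpace.comap U inferInstance →
      CondIdentDistrib μ H
        (fun ω => (1 - P ω) * J ω * (1 - P ω))
        (fun ω => (1 - P ω) * Jt ω * (1 - P ω)) ∧
      CondIdentDistrib μ H
        J
        (fun ω => (1 - P ω) * Jt ω * (1 - P ω) + J ω * P ω + P ω * J ω * (1 - P ω))) := by
  let Q (w : SpinConfig N × (ℕ → Fin N → unitInterval)) (A : Matrix (Fin N) (Fin N) ℝ) :=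
    projMatrix (revealedBlocks K n c A w.2 w.1 t j)
  have hPQ (ω : Ω) : P ω = Q (σ₀ ω, U ω) (J ω) :=
    (hP ω).trans (scanProj_eq_projMatrix K n c (J ω) (U ω) (σ₀ ω) t j)
  have := Measure.isProbabilityMeasure_map (μ := μ) hJ_meas.aemeasurable
  have hlaw := measurePreserving_prodMk_prodMk (hσ₀_meas.prodMk hU_meas) hJ_meas hJt_meas
    (hJt.map_eq hJ) hJ_indep hJt_indep
  have hQm : Measurable (Function.uncurry Q) := measurable_projMatrix_revealedBlocks hc K n
    measurable_snd measurable_fst.snd measurable_fst.fst t j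
  have hQ w A : IsIdempotentElem (Q w A) := (isStarProjection_projMatrix _).isIdempotentElem
  have hrev w : RevealedBy (Q w) (Q w) :=
    revealedBy_projMatrix_revealedBlocks hN c w.2 w.1 t j
  have hinv w : MeasurePreserving (fun x => resample (Q w x.1) x.1 x.2)
      ((μ.map J).prod (μ.map J)) (μ.map J) :=
    measurePreserving_resample_revealedBlocks hN hc (fun _ => hJ.measurePreserving_resample hJt
      (hJt_indep.comp measurable_id measurable_fst).symm) w.2 w.1 t j
  refine ⟨hPQ, fun H hH => ?_⟩
  have hobs := hH.trans (scanFiltration_sup_comap_le hN hc J U σ₀ t j)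
  have hcompress := condIdentDistrib_compress hlaw hQm hQ hrev hinv hobs
  have hresample := condIdentDistrib_resample hlaw hQm hQ hrev hinv hobs measurable_snd
  simp only [compress_apply, resample_eq, ← hPQ] at hcompress hresample
  exact ⟨hcompress, hresample⟩

theorem mainTheorem6
    {Ω : Type*} [mΩ : MeasurableSpace Ω] (μ : Measure Ω) [IsProbabilityMeasure μ]
    -- `K = 1/δ` blocks of size `n = δN`
    (N K n : ℕ) (hN : N = K * n)
    -- the update rule
    (c : unitInterval → ℝ → ℤˣ) (hc : Measurable (Function.uncurry c))
    -- the disorder, the initial configuration, the seeds, and the fresh GOE matrix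
    (J : Ω → Matrix (Fin N) (Fin N) ℝ) (σ₀ : Ω → SpinConfig N)
    (U : Ω → ℕ → Fin N → unitInterval) (Jt : Ω → Matrix (Fin N) (Fin N) ℝ)
    (hJ_meas : Measurable J) (hσ₀_meas : Measurable σ₀) (hU_meas : Measurable U)
    (hJt_meas : Measurable Jt)
    (hJ : IsGOE J μ) (hJt : IsGOE Jt μ)
    (hσ₀ : μ.map σ₀ = uniformOn Set.univ)
    (hU_law : ∀ t i, μ.map (fun ω => U ω t i) = volume)
    (hU_indep : iIndepFun (fun (p : ℕ × Fin N) ω => U ω p.1 p.2) μ)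
    -- `σ₀`, `U`, `J`, `Jt` are independent
    (hσ₀U : IndepFun σ₀ U μ)
    (hJ_indep : IndepFun J (fun ω => (σ₀ ω, U ω)) μ)
    (hJt_indep : IndepFun Jt (fun ω => (J ω, σ₀ ω, U ω)) μ)
    (t j : ℕ) (hj : j ∈ Finset.Icc 1 K)
    (P : Ω → Matrix (Fin N) (Fin N) ℝ)
    (hP : ∀ ω, P ω = scanProj K n c (J ω) (U ω) (σ₀ ω) t j) :
    -- `P` is the projector onto the span of the spin blocks revealed before time `(t, j)`
    (∀ ω, P ω = projMatrix
      ((fun p => spinBlock K n c (J ω) (U ω) (σ₀ ω) p.1 p.2) '' earlierTimes K t j)) ∧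
    -- the conditional laws given `F_j^t`, possibly enlarged by seeds
    (∀ H : MeasurableSpace Ω,
      scanFiltration K n c J U σ₀ t j ≤ H →
      H ≤ scanFiltration K n c J U σ₀ t j ⊔ MeasurableSpace.comap U inferInstance →
      CondIdentDistrib μ H
        (fun ω => (1 - P ω) * J ω * (1 - P ω))
        (fun ω => (1 - P ω) * Jt ω * (1 - P ω)) ∧
      CondIdentDistrib μ H
        J
        (fun ω => (1 - P ω) * Jt ω * (1 - P ω) + J ω * P ω + P ω * J ω * (1 - P ω))) :=
  have h := mainTheorem6_general μ N K n hN.le c hc J σ₀ U Jt hJ_meas hσ₀_meas hU_meas hJt_meas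
    hJ hJt hJ_indep hJt_indep t j P hP
  ⟨h.1, fun H _ => h.2 H⟩
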